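/- For integers $m,n\ge 3$, a \emph{dicyclic graph} $[m,n]$ is a simple graph composed of an $m$-cycle and an $n$-cycle (on disjoint node sets) linked by a single edge; it has exactly two nodes of degree $3$, the endpoints of the linking edge. It is \emph{symmetric} if $m=n$. Consider message-passing GNNs with layers $t=0,1,\dots,L$ of the form $$h_v^{(t+1)}=\sigma\Big(W^{(t)}_{\mathrm{upd}}h_v^{(t)}+W^{(t)}_{\mathrm{agg}}\sum_{u\in\mathcal N_v}h_u^{(t)}+b^{(t)}\Big),\qquad h_v^{(0)}=\alpha_v\in\mathbb R^k,$$ where $\mathcal N_v$ is the set of neighbours of $v$, $\sigma$ is the ReLU activation $x\mapsto\max(x,0)$ applied element-wise, $W^{(0)}_{\mathrm{upd}},W^{(0)}_{\mathrm{agg}}\in\mathbb R^{h\times k}$, $W^{(t)}_{\mathrm{upd}},W^{(t)}_{\mathrm{agg}}\in\mathbb R^{h\times h}$ for $t\ge 1$, and $b^{(t)}\in\mathbb R^h$. Let READOUT be the function of the graph and its final hidden states $h^{(L+1)}$ that equals $1$ if the nodes of degree $3$ have the same hidden state and $0$ otherwise. Then GNNs of this form can classify symmetric dicyclic graphs, with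 a number of layers governed by the maximal cycle length. More precisely, for every feature dimension $k\in\mathbb N$ there are a hidden dimension $h$ and a sequence of parameters $(W^{(t)}_{\mathrm{upd}},W^{(t)}_{\mathrm{agg}},b^{(t)})_{t\ge 0}$ such that, for every $L\in\mathbb N$, the GNN with the layers $0,\dots,L$ of this sequence, followed by READOUT, outputs $1$ if $m=n$ and $0$ if $m\ne n$ on every dicyclic graph $[m,n]$ with $3\le m,n\le L$ and with uniform node features ($\alpha_v=c$ for all nodes $v$), for every $c\in\mathbb R^k$. -/

import Mathlib

open scoped Matrix

/-- The standard dicyclic graph: an `m`-cycle on the vertices `Sum.inl i` and an `n`-cycle on the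
vertices `Sum.inr j`, linked by the single edge between vertex `0` of the first cycle and vertex
`0` of the second. (It is meant for `3 ≤ m` and `3 ≤ n`, where both parts really are cycles.) -/
def dicyclicGraph (m n : ℕ) : SimpleGraph (Fin m ⊕ Fin n) where
  Adj
    | Sum.inl i, Sum.inl j => (SimpleGraph.cycleGraph m).Adj i j
    | Sum.inr i, Sum.inr j => (SimpleGraph.cycleGraph n).Adj i j
    | Sum.inl i, Sum.inr j => i.val = 0 ∧ j.val = 0
    | Sum.inr j, Sum.inl i => i.val = 0 ∧ j.val = 0
  symm := ⟨by
    rintro (i | i) (j | j) hij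
    · exact SimpleGraph.Adj.symm hij
    · exact hij
    · exact hij
    · exact SimpleGraph.Adj.symm hij⟩
  loopless := ⟨by
    rintro (i | i) hi
    · exact SimpleGraph.irrefl _ hi
    · exact SimpleGraph.irrefl _ hi⟩

/-- `G` is a dicyclic graph `[m, n]`: it consists of an `m`-cycle and an `n`-cycle
(`m, n ≥ 3`) linked by a single edge. The graph is symmetric when `m = n`. -/
def IsDicyclic {V : Type*} (G : SimpleGraph V) (m n : ℕ) : Prop :=
  3 ≤ m ∧ 3 ≤ n ∧ Nonempty (G ≃g dicyclicGraph m n)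

/-- The learnable parameters of one layer with input dimension `d` and output dimension `h`. -/
structure LayerParams (d h : ℕ) where
  /-- the matrix acting on the state of the node itself -/
  Wupd : Matrix (Fin h) (Fin d) ℝ
  /-- the matrix acting on the pooled states of the neighbours -/
  Wagg : Matrix (Fin h) (Fin d) ℝ
  /-- the bias -/
  b : Fin h → ℝ

/-- The learnable parameters of a graph neural network with feature dimension `k` and hidden
dimension `h`: an input layer (layer `0`), and layers `1, 2, …` (layer `t + 1` is `layer t`).
A network with layers `0, …, L` only uses the first `L` entries of `layer`. -/
structure GNNParams (k h : ℕ) where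
  /-- layer `0`, from feature dimension `k` to hidden dimension `h` -/
  input : LayerParams k h
  /-- layers `1, 2, …` -/
  layer : ℕ → LayerParams h h

/-- An aggregating operator, turning a multiset of vectors into a vector, in every dimension. -/
abbrev Pooling : Type := (d : ℕ) → Multiset (Fin d → ℝ) → (Fin d → ℝ)

/-- Sum pooling. -/
def sumPool : Pooling := fun _ s => s.sum

/-- The rectified linear unit. -/
noncomputable def relu (x : ℝ) : ℝ := max x 0

section GNN

variable {V : Type*} [Fintype V] (G : SimpleGraph V) [DecidableRel G.Adj]

/-- One message passing step
`x_v ↦ σ (Wupd x_v + Wagg POOL {{x_u | u ∈ N_v}} + b)`, with `σ` applied element-wise. -/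
def messagePassing (σ : ℝ → ℝ) (pool : Pooling) {d h : ℕ} (P : LayerParams d h)
    (x : V → Fin d → ℝ) : V → Fin h → ℝ :=
  fun v i => σ ((P.Wupd *ᵥ x v + P.Wagg *ᵥ pool d ((G.neighborFinset v).val.map x) + P.b) i)

/-- The hidden states computed by the layers `0, …, L` from the node features `α`. -/
def hiddenState (σ : ℝ → ℝ) (pool : Pooling) {k h : ℕ} (Θ : GNNParams k h)
    (α : V → Fin k → ℝ) : ℕ → V → Fin h → ℝ
  | 0 => messagePassing G σ pool Θ.input α
  | L + 1 => messagePassing G σ pool (Θ.layer L) (hiddenState σ pool Θ α L)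

open Classical in
/-- The READOUT: it outputs `1` if the nodes of degree three have the same hidden state,
and `0` otherwise. -/
noncomputable def degreeThreeReadout {h : ℕ} (x : V → Fin h → ℝ) : ℝ :=
  if ∀ u v : V, G.degree u = 3 → G.degree v = 3 → x u = x v then 1 else 0

end GNN

/-! Hidden dimension one suffices. Layer `0` discards the features and sets every state to `1`; each
later layer applies `θ + A`, with `A` the adjacency matrix and `θ ≥ 0` transcendental, so ReLU never
acts. Equality of final states is then equality in `ℤ[X]` of entries of `(X + A) ^ L 1`
(`lazyWalk_eq_iff_of_transcendental`), and differentiating in `X` recovers equality at every earlier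
time (`lazyWalk_X_eq_of_le`).

If the link ends agree at all these times, their histories determine the sums over the two nodes at
distance `i` from the link, identically on both cycles, until the shorter cycle closes up: there a
node of degree 3 faces nodes of degree 2 (`exists_ne_of_lt`). For equal lengths the exchange
symmetry gives equality. -/

open Polynomial

section LazyWalk

variable {V : Type*} [Fintype V] (G : SimpleGraph V) [DecidableRel G.Adj]

/-- The vector `(a + A) ^ t 1`, where `A` is the adjacency matrix of `G`: it counts walks of
length `t`, with weight `a` for each step that stays put. -/
def lazyWalk {R : Type*} [CommSemiring R] (a : R) : ℕ → V → R
  | 0 => fun _ => 1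
  | t + 1 => fun v => a * lazyWalk a t v + ∑ u ∈ G.neighborFinset v, lazyWalk a t u

lemma map_lazyWalk {R S : Type*} [CommSemiring R] [CommSemiring S] (φ : R →+* S) (a : R) (t : ℕ)
    (v : V) : φ (lazyWalk G a t v) = lazyWalk G (φ a) t v := by
  induction t generalizing v with
  | zero => simp [lazyWalk]
  | succ t ih => simp [lazyWalk, ih, map_sum]

lemma lazyWalk_nonneg {a : ℝ} (ha : 0 ≤ a) (t : ℕ) (v : V) : 0 ≤ lazyWalk G a t v := by
  induction t generalizing v with
  | zero => simp [lazyWalk]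
  | succ t ih =>
    exact add_nonneg (mul_nonneg ha (ih v)) (Finset.sum_nonneg fun u _ => ih u)

/-- The power rule for `(X + A) ^ (t + 1)`, since `A` is constant in `X`. -/
lemma derivative_lazyWalk_X (t : ℕ) (v : V) :
    derivative (lazyWalk G (X : ℤ[X]) (t + 1) v) = (t + 1 : ℤ[X]) * lazyWalk G X t v := by
  induction t generalizing v with
  | zero => simp [lazyWalk]
  | succ t ih =>
    rw [lazyWalk, derivative_add, derivative_mul, derivative_sum, derivative_X, ih]
    simp only [ih, ← Finset.mul_sum]
    nth_rw 1 [lazyWalk]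
    conv_rhs => rw [lazyWalk]
    push_cast
    ring

lemma lazyWalk_X_eq_of_le {u v : V} {L : ℕ}
    (h : lazyWalk G (X : ℤ[X]) L u = lazyWalk G X L v) {t : ℕ} (ht : t ≤ L) :
    lazyWalk G (X : ℤ[X]) t u = lazyWalk G X t v := by
  induction L with
  | zero => rwa [Nat.le_zero.1 ht]
  | succ L ih =>
    rcases Nat.le_succ_iff.1 ht with ht | rfl
    · refine ih ?_ ht
      have h' := congrArg derivative h
      rw [derivative_lazyWalk_X, derivative_lazyWalk_X] at h'
      exact mul_left_cancel₀ (by exact_mod_cast Nat.succ_ne_zero L) h'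
    · exact h

end LazyWalk

/-! ### Neighbourhoods in dicyclic graphs -/

section Dicyclic

variable {V : Type*} [Fintype V] {G : SimpleGraph V} [DecidableRel G.Adj] {m n : ℕ}

lemma sum_neighborFinset_symm_inl (e : G ≃g dicyclicGraph (m + 3) (n + 3)) {R : Type*}
    [AddCommMonoid R] (x : V → R) (i : Fin (m + 3)) :
    ∑ u ∈ G.neighborFinset (e.symm (Sum.inl i)), x u =
      x (e.symm (Sum.inl (i - 1))) + x (e.symm (Sum.inl (i + 1))) +
        if i = 0 then x (e.symm (Sum.inr 0)) else 0 := by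
  classical
  -- Otherwise the neighbourhood in the cycle would be a singleton, against degree 2.
  have hne : i - 1 ≠ i + 1 := by
    have h := SimpleGraph.cycleGraph_degree_three_le (n := m) (v := i)
    rw [← SimpleGraph.card_neighborFinset_eq_degree, SimpleGraph.cycleGraph_neighborFinset] at h
    intro h'
    simp [h'] at h
  have hN : G.neighborFinset (e.symm (Sum.inl i)) =
      ((({i - 1, i + 1} : Finset (Fin (m + 3))).disjSum
        (if i = 0 then {(0 : Fin (n + 3))} else ∅)).map e.symm.toEquiv.toEmbedding) := by
    ext u
    obtain ⟨y, rfl⟩ := e.symm.surjective u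
    rw [SimpleGraph.mem_neighborFinset, SimpleGraph.Iso.map_adj_iff]
    change _ ↔ e.symm.toEquiv.toEmbedding y ∈ _
    rw [Finset.mem_map']
    rcases y with j | j
    · have := SimpleGraph.cycleGraph_neighborFinset (n := m + 1) (v := i)
      have h2 : (SimpleGraph.cycleGraph (m + 3)).Adj i j ↔ j = i - 1 ∨ j = i + 1 := by
        rw [← SimpleGraph.mem_neighborFinset, this]; simp
      simpa [dicyclicGraph] using h2
    · by_cases hi : i = 0 <;> simp [dicyclicGraph, hi]
  rw [hN, Finset.sum_map, Finset.sum_disjSum, Finset.sum_pair hne]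
  by_cases hi : i = 0 <;> simp [hi]

/-- Exchanging the two cycles. -/
def dicyclicGraphSwap (m n : ℕ) : dicyclicGraph m n ≃g dicyclicGraph n m where
  toEquiv := Equiv.sumComm _ _
  map_rel_iff' := by
    rintro (i | i) (j | j) <;> simp [dicyclicGraph, and_comm]

lemma sum_neighborFinset_symm_inr (e : G ≃g dicyclicGraph (m + 3) (n + 3)) {R : Type*}
    [AddCommMonoid R] (x : V → R) (j : Fin (n + 3)) :
    ∑ u ∈ G.neighborFinset (e.symm (Sum.inr j)), x u =
      x (e.symm (Sum.inr (j - 1))) + x (e.symm (Sum.inr (j + 1))) +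
        if j = 0 then x (e.symm (Sum.inl 0)) else 0 :=
  sum_neighborFinset_symm_inl (e.trans (dicyclicGraphSwap _ _)) x j

lemma degree_symm_inl (e : G ≃g dicyclicGraph (m + 3) (n + 3)) (i : Fin (m + 3)) :
    G.degree (e.symm (Sum.inl i)) = 3 ↔ i = 0 := by
  have h := sum_neighborFinset_symm_inl e (fun _ => 1) i
  rw [← Finset.card_eq_sum_ones, SimpleGraph.card_neighborFinset_eq_degree] at h
  rw [h]
  split_ifs <;> simp_all

lemma degree_symm_inr (e : G ≃g dicyclicGraph (m + 3) (n + 3)) (j : Fin (n + 3)) :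
    G.degree (e.symm (Sum.inr j)) = 3 ↔ j = 0 :=
  degree_symm_inl (e.trans (dicyclicGraphSwap _ _)) j

/-- The degree three nodes agree if and only if the two ends of the linking edge agree. -/
lemma forall_degree_three_iff (e : G ≃g dicyclicGraph (m + 3) (n + 3)) {α : Type*} (x : V → α) :
    (∀ u v : V, G.degree u = 3 → G.degree v = 3 → x u = x v) ↔
      x (e.symm (Sum.inl 0)) = x (e.symm (Sum.inr 0)) := by
  refine ⟨fun h => h _ _ ((degree_symm_inl e 0).2 rfl) ((degree_symm_inr e 0).2 rfl),
    fun h u v hu hv => ?_⟩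
  obtain ⟨u, rfl⟩ := e.symm.surjective u
  obtain ⟨v, rfl⟩ := e.symm.surjective v
  rcases u with u | u <;> rcases v with v | v <;>
    simp only [degree_symm_inl, degree_symm_inr] at hu hv <;> subst hu <;> subst hv <;>
    simp [h]

lemma lazyWalk_inl_eq_inr (e : G ≃g dicyclicGraph (m + 3) (m + 3)) {R : Type*} [CommSemiring R]
    (a : R) (t : ℕ) (i : Fin (m + 3)) :
    lazyWalk G a t (e.symm (Sum.inl i)) = lazyWalk G a t (e.symm (Sum.inr i)) := by
  induction t generalizing i with
  | zero => rfl
  | succ t ih =>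
    simp only [lazyWalk, sum_neighborFinset_symm_inl, sum_neighborFinset_symm_inr, ih]

end Dicyclic

/-! ### Separating cycles of different lengths -/

/-- A solution of the recurrence `s (t + 1) i = a * s t i + s t (i - 1) + s t (i + 1)` is determined
by its values at `i = 0` and `i = 1`. -/
lemma eq_of_eq_zero_one {R : Type*} [CommRing R] {a : R} {s r : ℕ → ℕ → R} {m T : ℕ}
    (hs : ∀ t i, i + 1 < m → s (t + 1) (i + 1) = a * s t (i + 1) + s t i + s t (i + 2))
    (hr : ∀ t i, i + 1 < m → r (t + 1) (i + 1) = a * r t (i + 1) + r t i + r t (i + 2))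
    (h0 : ∀ t, t ≤ T → s t 0 = r t 0) (h1 : ∀ t, t + 1 ≤ T → s t 1 = r t 1) :
    ∀ i t, i ≤ m → t + i ≤ T → s t i = r t i := by
  intro i
  induction i using Nat.strong_induction_on with
  | _ i ih =>
    intro t hi ht
    match i with
    | 0 => exact h0 t ht
    | 1 => exact h1 t ht
    | i + 2 =>
      -- The recurrence is solved for its term at `i + 2`: each step in position costs one step in
      -- time, hence the bound on `t + i`.
      have e1 := ih (i + 1) (by omega) (t + 1) (by omega) (by omega)
      have e2 := ih (i + 1) (by omega) t (by omega) (by omega)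
      have e3 := ih i (by omega) t (by omega) (by omega)
      rw [hs t i (by omega), hr t i (by omega), e2, e3] at e1
      exact add_left_cancel e1

open Fin.CommRing in
/-- Along a cycle, the symmetrised walk count satisfies the recurrence of `eq_of_eq_zero_one`. -/
lemma symmetrised_recurrence {R : Type*} [CommRing R] {a : R} {m : ℕ} {f : ℕ → Fin (m + 3) → R}
    (hf : ∀ t i, i ≠ 0 → f (t + 1) i = a * f t i + (f t (i - 1) + f t (i + 1)))
    (t i : ℕ) (hi : i + 1 < m + 3) :
    f (t + 1) ((i + 1 : ℕ) : Fin (m + 3)) + f (t + 1) (-((i + 1 : ℕ) : Fin (m + 3))) =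
      a * (f t ((i + 1 : ℕ) : Fin (m + 3)) + f t (-((i + 1 : ℕ) : Fin (m + 3)))) +
        (f t ((i : ℕ) : Fin (m + 3)) + f t (-((i : ℕ) : Fin (m + 3)))) +
        (f t ((i + 2 : ℕ) : Fin (m + 3)) + f t (-((i + 2 : ℕ) : Fin (m + 3)))) := by
  have h0 : ((i + 1 : ℕ) : Fin (m + 3)) ≠ 0 := by
    rw [Ne, Fin.ext_iff, Fin.val_natCast, Nat.mod_eq_of_lt hi]
    simp
  rw [hf t _ h0, hf t _ (neg_ne_zero.2 h0)]
  have e1 : ((i + 1 : ℕ) : Fin (m + 3)) - 1 = (i : ℕ) := by push_cast; ring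
  have e2 : ((i + 1 : ℕ) : Fin (m + 3)) + 1 = (i + 2 : ℕ) := by push_cast; ring
  have e3 : -((i + 1 : ℕ) : Fin (m + 3)) - 1 = -((i + 2 : ℕ) : Fin (m + 3)) := by push_cast; ring
  have e4 : -((i + 1 : ℕ) : Fin (m + 3)) + 1 = -((i : ℕ) : Fin (m + 3)) := by push_cast; ring
  rw [e1, e2, e3, e4]
  ring

open Fin.CommRing in
/-- Walk counts on two linked cycles of different lengths differ at the ends of the link. -/
lemma exists_ne_of_lt {R : Type*} [CommRing R] [CharZero R] [NoZeroDivisors R] {a : R} {m n : ℕ}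
    {f : ℕ → Fin (m + 3) → R} {g : ℕ → Fin (n + 3) → R} (hmn : m < n)
    (hf0 : ∀ i, f 0 i = 1) (hg0 : ∀ i, g 0 i = 1)
    (hf : ∀ t i, f (t + 1) i =
      a * f t i + (f t (i - 1) + f t (i + 1) + if i = 0 then g t 0 else 0))
    (hg : ∀ t i, g (t + 1) i =
      a * g t i + (g t (i - 1) + g t (i + 1) + if i = 0 then f t 0 else 0)) :
    ∃ t ≤ n + 3, f t 0 ≠ g t 0 := by
  by_contra! h
  -- The comparison is made at position `m + 3` and time `1`, as all counts are `1` at time `0`; `m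
  -- < n` gives `m + 4 ≤ n + 3`.
  have key := eq_of_eq_zero_one (a := a) (m := m + 3) (T := m + 4)
    (s := fun t i => f t (i : Fin (m + 3)) + f t (-(i : Fin (m + 3))))
    (r := fun t i => g t (i : Fin (n + 3)) + g t (-(i : Fin (n + 3))))
    (symmetrised_recurrence fun t i hi => by rw [hf, if_neg hi, add_zero])
    (fun t i hi => symmetrised_recurrence
      (fun t i hi => by rw [hg, if_neg hi, add_zero]) t i (by omega))
    (fun t ht => by simp [h t (by omega)])
    -- The update at a link end reveals the sum over its two cycle neighbours, the link terms being
    -- equal by assumption.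
    (fun t ht => by
      have h1 := h (t + 1) (by omega)
      rw [hf, hg, if_pos rfl, if_pos rfl, h t (by omega)] at h1
      simp only [Nat.cast_one, zero_sub, zero_add] at h1 ⊢
      linear_combination h1)
    (m + 3) 1 le_rfl (by omega)
  have hm : ((m + 3 : ℕ) : Fin (m + 3)) = 0 := by simp
  have hn : ((m + 3 : ℕ) : Fin (n + 3)) ≠ 0 := by
    rw [Ne, Fin.ext_iff, Fin.val_natCast, Nat.mod_eq_of_lt (by omega)]
    simp
  simp only [hm, neg_zero] at key
  -- Time-one values are `a` plus the degree, so `key` reads `2 (a + 3) = 2 (a + 2)`.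
  rw [hf 0, hg 0, hg 0, if_pos rfl, if_neg hn, if_neg (neg_ne_zero.2 hn)] at key
  simp only [hf0, hg0] at key
  have h2 : (2 : R) = 0 := by linear_combination key
  exact two_ne_zero h2

lemma lazyWalk_X_ne {V : Type*} [Fintype V] {G : SimpleGraph V} [DecidableRel G.Adj] {m n L : ℕ}
    (e : G ≃g dicyclicGraph (m + 3) (n + 3)) (hmn : m ≠ n) (hm : m + 3 ≤ L) (hn : n + 3 ≤ L) :
    lazyWalk G (X : ℤ[X]) L (e.symm (Sum.inl 0)) ≠ lazyWalk G X L (e.symm (Sum.inr 0)) := by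
  intro h
  have hf (t : ℕ) (i : Fin (m + 3)) := congrArg
    (X * lazyWalk G (X : ℤ[X]) t (e.symm (Sum.inl i)) + ·)
    (sum_neighborFinset_symm_inl e (lazyWalk G (X : ℤ[X]) t) i)
  have hg (t : ℕ) (i : Fin (n + 3)) := congrArg
    (X * lazyWalk G (X : ℤ[X]) t (e.symm (Sum.inr i)) + ·)
    (sum_neighborFinset_symm_inr e (lazyWalk G (X : ℤ[X]) t) i)
  rcases hmn.lt_or_gt with hlt | hlt
  · obtain ⟨t, ht, hne⟩ := exists_ne_of_lt (a := (X : ℤ[X]))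
      (f := fun t i => lazyWalk G X t (e.symm (Sum.inl i)))
      (g := fun t i => lazyWalk G X t (e.symm (Sum.inr i))) hlt
      (fun _ => rfl) (fun _ => rfl) hf hg
    exact hne (lazyWalk_X_eq_of_le G h (ht.trans hn))
  · obtain ⟨t, ht, hne⟩ := exists_ne_of_lt (a := (X : ℤ[X]))
      (f := fun t i => lazyWalk G X t (e.symm (Sum.inr i)))
      (g := fun t i => lazyWalk G X t (e.symm (Sum.inl i))) hlt
      (fun _ => rfl) (fun _ => rfl) hg hf
    exact hne (lazyWalk_X_eq_of_le G h.symm (ht.trans hm))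

/-! ### The network and its readout -/

/-- The network with hidden dimension one that sets every state to `1` and then iterates
`x_v ↦ θ x_v + ∑ u ∈ N_v, x_u`. -/
def lazyWalkParams (k : ℕ) (θ : ℝ) : GNNParams k 1 where
  input := ⟨0, 0, 1⟩
  layer _ := ⟨θ • 1, 1, 0⟩

lemma hiddenState_lazyWalkParams {V : Type*} [Fintype V] (G : SimpleGraph V) [DecidableRel G.Adj]
    {k : ℕ} {θ : ℝ} (hθ : 0 ≤ θ) (α : V → Fin k → ℝ) (L : ℕ) :
    hiddenState G relu sumPool (lazyWalkParams k θ) α L = fun v _ => lazyWalk G θ L v := by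
  induction L with
  | zero =>
    ext v i
    simp [hiddenState, messagePassing, lazyWalkParams, lazyWalk, relu]
  | succ L ih =>
    ext v i
    have hsum : ((G.neighborFinset v).val.map fun u (_ : Fin 1) => lazyWalk G θ L u).sum =
        fun _ => ∑ u ∈ G.neighborFinset v, lazyWalk G θ L u := by
      change (∑ u ∈ G.neighborFinset v, fun _ : Fin 1 => lazyWalk G θ L u) = _
      ext j
      simp [Finset.sum_apply]
    have h := lazyWalk_nonneg G hθ (L + 1) v
    rw [hiddenState, ih]
    simp only [messagePassing, lazyWalkParams, sumPool, hsum, relu]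
    simpa [lazyWalk, Matrix.smul_mulVec] using h

/-- Evaluation at a transcendental `θ` is injective on `ℤ[X]`. -/
lemma lazyWalk_eq_iff_of_transcendental {V : Type*} [Fintype V] (G : SimpleGraph V)
    [DecidableRel G.Adj] {θ : ℝ} (hθ : Transcendental ℤ θ) (t : ℕ) (u v : V) :
    lazyWalk G θ t u = lazyWalk G θ t v ↔
      lazyWalk G (X : ℤ[X]) t u = lazyWalk G X t v := by
  have h (w : V) : aeval θ (lazyWalk G (X : ℤ[X]) t w) = lazyWalk G θ t w := by
    simpa using map_lazyWalk G (aeval θ : ℤ[X] →ₐ[ℤ] ℝ).toRingHom X t w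
  rw [← h, ← h]
  exact (transcendental_iff_injective.1 hθ).eq_iff

theorem corollary1 (k : ℕ) :
    ∃ (h : ℕ) (Θ : GNNParams k h),
      ∀ (L m n : ℕ), m ≤ L → n ≤ L →
        ∀ (V : Type*) [Fintype V] (G : SimpleGraph V) [DecidableRel G.Adj], IsDicyclic G m n →
          ∀ c : Fin k → ℝ,
            degreeThreeReadout G (hiddenState G relu sumPool Θ (fun _ => c) L) =
              if m = n then 1 else 0 := by
  -- Any nonnegative transcendental number would do.
  have hθ : Transcendental ℤ (liouvilleNumber (2 : ℕ)) := transcendental_liouvilleNumber le_rfl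
  have hθ0 : 0 ≤ liouvilleNumber (2 : ℕ) := tsum_nonneg fun i => by positivity
  refine ⟨1, lazyWalkParams k (liouvilleNumber (2 : ℕ)), ?_⟩
  rintro L m n hm hn V _ G _ ⟨hm3, hn3, ⟨e⟩⟩ c
  obtain ⟨m, rfl⟩ := Nat.exists_eq_add_of_le' hm3
  obtain ⟨n, rfl⟩ := Nat.exists_eq_add_of_le' hn3
  rw [hiddenState_lazyWalkParams G hθ0, degreeThreeReadout]
  refine if_congr ?_ rfl rfl
  rw [forall_degree_three_iff e, funext_iff, forall_const,
    lazyWalk_eq_iff_of_transcendental G hθ]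
  constructor
  · intro h
    by_contra hmn
    exact lazyWalk_X_ne e (by omega) hm hn h
  · intro hmn
    obtain rfl : m = n := by omega
    exact lazyWalk_inl_eq_inr e X L 0
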